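/- Let $d\ge 3$. A Feynman diagram of the purely quartic melonic model of rank $d$ is built as follows. Each of its $V$ vertices is a quartic melonic bubble of some colour $i\in\{1,\dots,d\}$: it has two white nodes $w_1,w_2$ (fields $T$) and two black nodes $b_1,b_2$ (fields $\bar T$), where for $k=1,2$ the nodes $w_k,b_k$ are joined by $d-1$ edges, one for each colour $j\ne i$, and the two remaining edges $w_1b_2$ and $w_2b_1$ have colour $i$. Internal edges (propagators, colour $0$) join white nodes to black nodes, each node being hooked to at most one of them; a node hooked to no internal edge is hooked to exactly one external edge. Let $L$ be the number of internal edges. A face of colour $i\in\{1,\dots,d\}$ is a connected component of the subgraph formed by the edges of colours $0$ and $i$; it is external if it contains an external edge and internal otherwise, and its length is the number of its edges of colour $i$. A face runs through the interior of the diagram if it contains an internal edge. Let $F$ be the number of internal faces. A connected diagram with at least one external edge is called melonic if $F$ takes its optimal value, $F=(d-1)(L-V+1)$. A diagram is 1PI if it is connected and remains connected after the deletion of any one internal edge. An external vertex is a vertex hooked to at least one external edge. Let $\mathcal G_N$ be a 1PI melonic diagram of this model with $2N$ external edges, $N\ge 1$, and more than one vertex. Then: 1. every external vertex is hooked to exactly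 two external edges, and these two edges share exactly $d-1$ external faces of length one; 2. there are exactly $N$ external faces that run through the interior of the diagram, and they all have the same colour. -/

import Mathlib

/-- A Feynman diagram of the purely quartic melonic tensorial field theory of rank `d`, with
interaction vertices labelled by `V`. The vertex `v` is the quartic melonic bubble with
distinguished colour `colour v`. It has two white nodes (fields `T`) and two black nodes
(fields `T̄`), each labelled by `(v, s)` with `s : Bool`. An internal edge (propagator, colour `0`)
joins a white node to a black node, every node being hooked to at most one internal edge. -/
structure QuarticDiagram (d : ℕ) (V : Type*) where
  /-- the distinguished colour of each quartic melonic bubble -/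
  colour : V → Fin d
  /-- the internal edges: `b ∈ line w` means that `w` (white) and `b` (black) are contracted -/
  line : (V × Bool) ≃. (V × Bool)

namespace QuarticDiagram

/-- The nodes of a diagram: `Sum.inl` are the white ones, `Sum.inr` the black ones. -/
abbrev Node (V : Type*) : Type _ := (V × Bool) ⊕ (V × Bool)

/-- The interaction vertex to which a node belongs. -/
def Node.vertex {V : Type*} : Node V → V
  | Sum.inl w => w.1
  | Sum.inr b => b.1

variable {d : ℕ} {V : Type*} (G : QuarticDiagram d V)

open Classical in
/-- The black node joined to the white node `w` by the edge of colour `i` of its bubble: in the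
bubble `v`, the nodes `(v, s)` of the two kinds are joined by the `d - 1` colours other than
`colour v`, and the edges of colour `colour v` join white `(v, s)` to black `(v, !s)`. -/
noncomputable def bubbleEdge (i : Fin d) (w : V × Bool) : V × Bool :=
  if i = G.colour w.1 then (w.1, !w.2) else w

/-- A node hooked to an external edge, i.e. to no internal edge. Nodes of this kind are in bijection
with the external edges. -/
def IsExternalNode : Node V → Prop
  | Sum.inl w => G.line w = none
  | Sum.inr b => G.line.symm b = none

/-- The external edges, each represented by the node it is hooked to. -/
def externalEdges : Set (Node V) := {x | G.IsExternalNode x}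

/-- The external edges hooked to the vertex `v`. -/
def externalEdgesAt (v : V) : Set (Node V) := {x ∈ G.externalEdges | Node.vertex x = v}

/-- An external vertex is one that is hooked to at least one external edge. -/
def IsExternalVertex (v : V) : Prop := (G.externalEdgesAt v).Nonempty

/-- The internal edges, each represented by its white end. -/
def internalEdges : Set (V × Bool) := {w | (G.line w).isSome}

/-- The graph on the interaction vertices in which two vertices are adjacent when they are joined
by an internal edge that is not in `S`. -/
def vertexGraph (S : Set (V × Bool)) : SimpleGraph V :=
  SimpleGraph.fromRel fun u v => ∃ s t, (u, s) ∉ S ∧ (v, t) ∈ G.line (u, s)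

/-- The diagram is connected. -/
def IsConnected : Prop := (G.vertexGraph ∅).Connected

/-- One-particle irreducibility: the diagram is connected, and it remains so after the deletion of
any one internal edge. -/
def IsOnePI : Prop :=
  G.IsConnected ∧ ∀ w ∈ G.internalEdges, (G.vertexGraph {w}).Connected

/-- The spanning subgraph of edges of colours `0` and `i`. -/
def stranded (i : Fin d) : SimpleGraph (Node V) :=
  SimpleGraph.fromRel fun x y =>
    ∃ w b, x = Sum.inl w ∧ y = Sum.inr b ∧ (G.bubbleEdge i w = b ∨ b ∈ G.line w)

/-- A face of colour `i` is a connected component of the subgraph of colours `0` and `i`. -/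
abbrev Face : Type _ := Σ i : Fin d, (G.stranded i).ConnectedComponent

namespace Face

variable {G}

/-- The colour of a face. -/
def colour (f : G.Face) : Fin d := f.1

/-- The nodes through which a face passes. -/
def nodes (f : G.Face) : Set (Node V) := f.2.supp

/-- A face is external (open) if it contains an external edge. -/
def IsExternal (f : G.Face) : Prop := ∃ x ∈ f.nodes, G.IsExternalNode x

/-- The length of a face of colour `i`: the number of edges of colour `i` in it. Each of them has
exactly one white end, and each white node is the end of exactly one of them. An external face of
length one thus joins two external edges directly, by a single edge of a bubble. -/
noncomputable def length (f : G.Face) : ℕ := {w : V × Bool | Sum.inl w ∈ f.nodes}.ncard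

/-- A face runs through the interior of the diagram if it contains an internal edge. -/
def RunsThroughInterior (f : G.Face) : Prop := ∃ w ∈ G.internalEdges, Sum.inl w ∈ f.nodes

end Face

/-- The internal (closed) faces. -/
def internalFaces : Set G.Face := {f | ¬ f.IsExternal}

/-- The external (open) faces. -/
def externalFaces : Set G.Face := {f | f.IsExternal}

/-- Melonic diagrams with external edges: the connected diagrams whose number of internal faces is
optimal, `F = (d - 1) (L - V + 1)`. -/
def IsMelonic [Fintype V] : Prop :=
  G.IsConnected ∧
    (G.internalFaces.ncard : ℤ) =
      ((d : ℤ) - 1) * ((G.internalEdges.ncard : ℤ) - (Fintype.card V : ℤ) + 1)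

end QuarticDiagram

/-! Label the white and the black nodes by the same pairs `(v, s)` and extend the propagators to a
permutation `τ` each of whose cycles contains at most one point of the set X of externally hooked
white nodes (`PEquiv.exists_perm_extension`). In the intermediate field picture the cycles of `τ`
are the vertices of a graph, and each bubble `v` is an edge linking the cycles through `(v, false)`
and `(v, true)`. The internal faces of colour `i` are the cycles avoiding X of `τ` followed by the
exchange of the two points over every bubble of colour `i` (`ncard_internalFaces`).

Switch the bubbles on one at a time. Both `cyclomatic` and `defect` are monotone (`cyclomatic_mono`,
`defect_mono`). Let K be the number of cycles of `τ`. Comparing no bubbles with all of them gives K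
≤ V + 1 from the first and, with the melonic value of F, (d - 2)(V + 1 - K) ≤ 0 from the second. As
d ≥ 3, K = V + 1: the graph is a tree and both quantities are constant along the way
(`IsMelonic.cyclomatic_and_defect`).

In a 1PI diagram a longer cycle through a point of X could be cut at a propagator without
disconnecting the diagram, giving a connected graph with too many vertices for its V edges. So `τ`
fixes X pointwise (`IsOnePI.apply_eq_self`): external white and black nodes carry the same labels
and form leaves of the tree. Since there is more than one bubble, only one of the two ends of a
bubble can be such a leaf. The d - 1 edges inside the pair are the short faces; the remaining face
runs through the interior. If two external bubbles had different colours, detaching the leaves of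
the wrong colours and reattaching one would increase the defect (`colour_eq_of_mem_whiteExternal`).
Finally, faces of one colour through distinct points of X are distinct, and X has N elements. -/

/-! ### Equivalence relations: counting classes that avoid a set, and linking two classes -/

namespace Setoid

variable {α : Type*}

/-- The equivalence relation obtained from `r` by merging the classes of `a` and `b`. -/
def link (r : Setoid α) (a b : α) : Setoid α where
  r x y := r x y ∨ (r x a ∧ r b y) ∨ (r x b ∧ r a y)
  iseqv := by
    refine ⟨fun x => Or.inl (r.refl x), ?_, ?_⟩
    · rintro x y (h | ⟨h, h'⟩ | ⟨h, h'⟩)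
      · exact Or.inl (r.symm h)
      · exact Or.inr (Or.inr ⟨r.symm h', r.symm h⟩)
      · exact Or.inr (Or.inl ⟨r.symm h', r.symm h⟩)
    · rintro x y z (h | ⟨h, h'⟩ | ⟨h, h'⟩) (k | ⟨k, k'⟩ | ⟨k, k'⟩)
      · exact Or.inl (r.trans h k)
      · exact Or.inr (Or.inl ⟨r.trans h k, k'⟩)
      · exact Or.inr (Or.inr ⟨r.trans h k, k'⟩)
      · exact Or.inr (Or.inl ⟨h, r.trans h' k⟩)
      · exact Or.inr (Or.inl ⟨h, k'⟩)
      · exact Or.inl (r.trans h k')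
      · exact Or.inr (Or.inr ⟨h, r.trans h' k⟩)
      · exact Or.inl (r.trans h k')
      · exact Or.inr (Or.inr ⟨h, k'⟩)

theorem le_link (r : Setoid α) (a b : α) : r ≤ r.link a b := fun _ _ h => Or.inl h

theorem link_rel (r : Setoid α) (a b : α) : r.link a b a b :=
  Or.inr (Or.inl ⟨r.refl a, r.refl b⟩)

theorem link_le {r s : Setoid α} {a b : α} (h : r ≤ s) (hab : s a b) : r.link a b ≤ s := by
  rintro x y (k | ⟨k, k'⟩ | ⟨k, k'⟩)
  · exact h k
  · exact s.trans (h k) (s.trans hab (h k'))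
  · exact s.trans (h k) (s.trans (s.symm hab) (h k'))

theorem link_eq_self {r : Setoid α} {a b : α} (h : r a b) : r.link a b = r :=
  le_antisymm (link_le le_rfl h) (le_link r a b)

theorem link_comm (r : Setoid α) (a b : α) : r.link a b = r.link b a :=
  le_antisymm (link_le (le_link r b a) (Setoid.symm' _ (link_rel r b a)))
    (link_le (le_link r a b) (Setoid.symm' _ (link_rel r a b)))

/-- The classes of `r` that contain no element of `X`. -/
def avoiding (r : Setoid α) (X : Set α) : Set (Quotient r) :=
  {q | ∀ x ∈ X, (Quotient.mk r x) ≠ q}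

/-- The class of `a` contains an element of `X`. -/
def Meets (r : Setoid α) (X : Set α) (a : α) : Prop := ∃ x ∈ X, r x a

theorem mk_mem_avoiding {r : Setoid α} {X : Set α} {a : α} :
    Quotient.mk r a ∈ r.avoiding X ↔ ¬ r.Meets X a := by
  simp only [avoiding, Meets, Set.mem_ofPred_eq, not_exists, not_and]
  exact forall₂_congr fun x _ => not_congr Quotient.eq

theorem Meets.mono {r s : Setoid α} (h : r ≤ s) {X : Set α} {a : α} (ha : r.Meets X a) :
    s.Meets X a := by
  obtain ⟨x, hx, hxa⟩ := ha
  exact ⟨x, hx, h hxa⟩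

theorem Meets.of_rel {r : Setoid α} {X : Set α} {a b : α} (ha : r.Meets X a) (h : r a b) :
    r.Meets X b := by
  obtain ⟨x, hx, hxa⟩ := ha
  exact ⟨x, hx, r.trans hxa h⟩

/-- The number of classes of `r` that contain no element of `X`. -/
noncomputable def avoidCard (r : Setoid α) (X : Set α) : ℕ := (r.avoiding X).ncard

/-- The class of `a` represents the merged class: by `hX` it avoids `X` exactly when both classes
do, so only the class of `b` has to be dropped from the count. -/
theorem avoidCard_link_aux [Finite α] {r : Setoid α} {X : Set α} {a b : α} (hab : ¬ r a b)
    (hX : r.Meets X b → r.Meets X a) :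
    (r.link a b).avoidCard X = (r.avoiding X \ {Quotient.mk r b}).ncard := by
  let g : Quotient r → Quotient (r.link a b) :=
    Quotient.map' id fun x y h => le_link r a b h
  have hg : ∀ x, g (Quotient.mk r x) = Quotient.mk (r.link a b) x := fun _ => rfl
  have hinj : Set.InjOn g (r.avoiding X \ {Quotient.mk r b}) := by
    intro p
    induction p using Quotient.inductionOn with | _ x
    rintro ⟨-, hx⟩ q
    induction q using Quotient.inductionOn with | _ y
    rintro ⟨-, hy⟩ hxy
    rw [hg, hg, Quotient.eq] at hxy
    rw [Quotient.eq]
    simp only [Set.mem_singleton_iff, Quotient.eq] at hx hy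
    rcases hxy with h | ⟨h, h'⟩ | ⟨h, h'⟩
    · exact h
    · exact absurd (r.symm h') hy
    · exact absurd h hx
  have himg : g '' (r.avoiding X \ {Quotient.mk r b}) = (r.link a b).avoiding X := by
    ext q
    induction q using Quotient.inductionOn with | _ x
    constructor
    · rintro ⟨p, hp, hpx⟩
      rw [← hpx]
      clear hpx
      induction p using Quotient.inductionOn with | _ y
      obtain ⟨h1, h2⟩ := hp
      rw [hg, mk_mem_avoiding]
      rw [mk_mem_avoiding] at h1
      simp only [Set.mem_singleton_iff, Quotient.eq] at h2
      rintro ⟨z, hz, h | ⟨h, h'⟩ | ⟨h, h'⟩⟩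
      · exact h1 ⟨z, hz, h⟩
      · exact h2 (r.symm h')
      · exact h1 ((hX ⟨z, hz, h⟩).of_rel h')
    · intro hx
      rw [mk_mem_avoiding] at hx
      by_cases hxb : r x b
      · refine ⟨Quotient.mk r a, ⟨?_, ?_⟩, ?_⟩
        · rw [mk_mem_avoiding]
          exact fun h => hx ((h.mono (le_link r a b)).of_rel
            (Or.inr (Or.inl ⟨r.refl a, r.symm hxb⟩)))
        · simpa only [Set.mem_singleton_iff, Quotient.eq] using hab
        · rw [hg, Quotient.eq]
          exact Or.inr (Or.inl ⟨r.refl a, r.symm hxb⟩)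
      · refine ⟨Quotient.mk r x, ⟨?_, ?_⟩, hg x⟩
        · rw [mk_mem_avoiding]
          exact fun h => hx (h.mono (le_link r a b))
        · simpa only [Set.mem_singleton_iff, Quotient.eq] using hxb
  rw [avoidCard, ← himg, hinj.ncard_image]

theorem avoidCard_link_of_meets [Finite α] {r : Setoid α} {X : Set α} {a b : α} (hab : ¬ r a b)
    (ha : r.Meets X a) (hb : r.Meets X b) : (r.link a b).avoidCard X = r.avoidCard X := by
  rw [avoidCard_link_aux hab fun _ => ha, avoidCard, Set.sdiff_singleton_eq_self]
  rw [mk_mem_avoiding]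
  exact fun h => h hb

theorem avoidCard_link_of_not_meets [Finite α] {r : Setoid α} {X : Set α} {a b : α}
    (hab : ¬ r a b) (h : ¬ (r.Meets X a ∧ r.Meets X b)) :
    (r.link a b).avoidCard X + 1 = r.avoidCard X := by
  wlog hb : ¬ r.Meets X b generalizing a b
  · rw [link_comm]
    exact this (fun h => hab (r.symm h)) (fun h' => h h'.symm) fun ha => h ⟨ha, not_not.1 hb⟩
  rw [avoidCard_link_aux hab fun h => absurd h hb]
  exact Set.ncard_sdiff_singleton_add_one (mk_mem_avoiding.2 hb)

theorem avoidCard_link_le [Finite α] (r : Setoid α) (X : Set α) (a b : α) :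
    (r.link a b).avoidCard X ≤ r.avoidCard X := by
  by_cases hab : r a b
  · rw [link_eq_self hab]
  by_cases h : r.Meets X a ∧ r.Meets X b
  · rw [avoidCard_link_of_meets hab h.1 h.2]
  · rw [← avoidCard_link_of_not_meets hab h]
    exact Nat.le_succ _

theorem avoidCard_le_link_add_one [Finite α] (r : Setoid α) (X : Set α) (a b : α) :
    r.avoidCard X ≤ (r.link a b).avoidCard X + 1 := by
  by_cases hab : r a b
  · rw [link_eq_self hab]
    exact Nat.le_succ _
  by_cases h : r.Meets X a ∧ r.Meets X b
  · rw [avoidCard_link_of_meets hab h.1 h.2]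
    exact Nat.le_succ _
  · rw [← avoidCard_link_of_not_meets hab h]

/-- The number of classes of `r`. -/
noncomputable def classCard (r : Setoid α) : ℕ := r.avoidCard ∅

theorem not_meets_empty (r : Setoid α) (a : α) : ¬ r.Meets ∅ a := fun ⟨_, h, _⟩ => h

theorem classCard_link [Finite α] {r : Setoid α} {a b : α} (hab : ¬ r a b) :
    (r.link a b).classCard + 1 = r.classCard :=
  avoidCard_link_of_not_meets hab fun h => r.not_meets_empty a h.1

theorem classCard_eq_one [Nonempty α] {r : Setoid α} (h : ∀ x y, r x y) : r.classCard = 1 := by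
  obtain ⟨a⟩ := ‹Nonempty α›
  rw [classCard, avoidCard, Set.ncard_eq_one]
  refine ⟨Quotient.mk r a, Set.eq_singleton_iff_unique_mem.2
    ⟨mk_mem_avoiding.2 (r.not_meets_empty a), fun q _ => ?_⟩⟩
  induction q using Quotient.inductionOn with | _ x
  exact Quotient.sound (h x a)

theorem avoidCard_eq_zero {r : Setoid α} {X : Set α} (h : ∀ a, r.Meets X a) :
    r.avoidCard X = 0 := by
  have : r.avoiding X = ∅ := by
    refine Set.eq_empty_of_forall_notMem fun q => ?_
    induction q using Quotient.inductionOn with | _ x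
    exact fun hx => mk_mem_avoiding.1 hx (h x)
  rw [avoidCard, this, Set.ncard_empty]

/-- The classes that meet `X` are in bijection with `X`, since no class contains two of its points.
-/
theorem avoidCard_add_ncard [Finite α] {r : Setoid α} {X : Set α}
    (h : ∀ x ∈ X, ∀ y ∈ X, r x y → x = y) : r.avoidCard X + X.ncard = r.classCard := by
  have hinj : Set.InjOn (Quotient.mk r) X := fun x hx y hy hxy => h x hx y hy (Quotient.eq.1 hxy)
  have hcompl : r.avoiding X = (Quotient.mk r '' X)ᶜ := by
    ext q
    simp [avoiding]
  have huniv : r.avoiding ∅ = Set.univ := by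
    ext q
    simp [avoiding]
  rw [classCard, avoidCard, avoidCard, huniv, hcompl, ← hinj.ncard_image, add_comm,
    Set.ncard_add_ncard_compl, Set.ncard_univ]

end Setoid

/-! ### Cycles of a permutation multiplied by a transposition -/

namespace Equiv.Perm

variable {α : Type*}

/-- The equivalence relation whose classes are the cycles of a permutation. -/
abbrev cyc (f : Perm α) : Setoid α := SameCycle.setoid f

theorem cyc_le {f : Perm α} {s : Setoid α} (h : ∀ x, s x (f x)) : cyc f ≤ s := by
  have hpow : ∀ (n : ℕ) x, s x ((f ^ n) x) := by
    intro n
    induction n with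
    | zero => exact fun x => s.refl x
    | succ n ih =>
      intro x
      rw [pow_succ', mul_apply]
      exact s.trans (ih x) (h _)
  rintro x y ⟨i, rfl⟩
  obtain ⟨n, rfl | rfl⟩ := i.eq_nat_or_neg
  · exact hpow n x
  · have := hpow n ((f ^ (-(n : ℤ))) x)
    rw [← mul_apply, ← zpow_natCast, ← zpow_add, add_neg_cancel, zpow_zero, one_apply] at this
    exact s.symm this

theorem cyc_apply (f : Perm α) (x : α) : cyc f x (f x) := ⟨1, rfl⟩

variable [DecidableEq α]

theorem cyc_swap_mul_le (f : Perm α) (a b : α) : cyc (swap a b * f) ≤ (cyc f).link a b := by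
  refine cyc_le fun x => ?_
  have hx := Setoid.le_link (cyc f) a b (cyc_apply f x)
  rw [mul_apply]
  rcases eq_or_ne (f x) a with h | h
  · rw [h, swap_apply_left]
    rw [h] at hx
    exact Setoid.trans' _ hx (Setoid.link_rel _ a b)
  rcases eq_or_ne (f x) b with h' | h'
  · rw [h', swap_apply_right]
    rw [h'] at hx
    exact Setoid.trans' _ hx (Setoid.symm' _ (Setoid.link_rel _ a b))
  rwa [swap_apply_of_ne_of_ne h h']

theorem link_cyc_swap_mul (f : Perm α) (a b : α) :
    (cyc (swap a b * f)).link a b = (cyc f).link a b := by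
  refine le_antisymm (Setoid.link_le (cyc_swap_mul_le f a b) (Setoid.link_rel _ a b))
    (Setoid.link_le ?_ (Setoid.link_rel _ a b))
  have := cyc_swap_mul_le (swap a b * f) a b
  rwa [← mul_assoc, swap_mul_self, one_mul] at this

theorem sameCycle_swap_mul [Finite α] {f : Perm α} {a b : α} (h : ¬ cyc f a b) :
    cyc (swap a b * f) a b := by
  set g := swap a b * f with hg
  -- Follow the cycle of `a` backwards under `f`. It never meets `b`, so `g` agrees with `f` along
  -- it, except that `g` sends the predecessor of `a` to `b`.
  have key : ∀ n : ℕ, cyc g b ((f⁻¹ ^ n) (f⁻¹ a)) := by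
    have hstep : ∀ y, y ≠ a → y ≠ b → cyc g y (f⁻¹ y) := by
      intro y hya hyb
      have : g (f⁻¹ y) = y := by
        rw [hg, mul_apply, inv_def, apply_symm_apply, swap_apply_of_ne_of_ne hya hyb]
      have h' := cyc_apply g (f⁻¹ y)
      rw [this] at h'
      exact Setoid.symm' _ h'
    have h0 : cyc g b (f⁻¹ a) := by
      have : g (f⁻¹ a) = b := by
        rw [hg, mul_apply, inv_def, apply_symm_apply, swap_apply_left]
      have h' := cyc_apply g (f⁻¹ a)
      rw [this] at h'
      exact Setoid.symm' _ h'
    intro n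
    induction n with
    | zero => exact h0
    | succ n ih =>
      rw [pow_succ', mul_apply]
      set y := (f⁻¹ ^ n) (f⁻¹ a) with hy
      have hcy : cyc f a y := by
        refine ⟨-((n : ℤ) + 1), ?_⟩
        rw [hy, ← mul_apply, ← pow_succ, zpow_neg, inv_pow]
        rfl
      have hyb : y ≠ b := fun e => h (e ▸ hcy)
      rcases eq_or_ne y a with e | e
      · rw [e]
        exact h0
      · exact Setoid.trans' _ ih (hstep y e hyb)
  -- The backward walk returns to `a` after `orderOf f⁻¹` steps, the first of which is already taken
  -- in `key`.
  have hfin : IsOfFinOrder f⁻¹ := isOfFinOrder_of_finite _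
  have := key (orderOf f⁻¹ - 1)
  rw [← mul_apply, ← pow_succ, Nat.sub_add_cancel hfin.orderOf_pos, pow_orderOf_eq_one,
    one_apply] at this
  exact Setoid.symm' _ this

theorem cyc_swap_mul_of_not [Finite α] {f : Perm α} {a b : α} (h : ¬ cyc f a b) :
    cyc (swap a b * f) = (cyc f).link a b := by
  rw [← link_cyc_swap_mul, Setoid.link_eq_self (sameCycle_swap_mul h)]

theorem avoidCard_cyc_swap_mul_le [Finite α] (f : Perm α) (X : Set α) (a b : α) :
    (cyc (swap a b * f)).avoidCard X ≤ (cyc f).avoidCard X + 1 := by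
  refine (Setoid.avoidCard_le_link_add_one _ X a b).trans ?_
  rw [link_cyc_swap_mul]
  exact Nat.add_le_add_right (Setoid.avoidCard_link_le _ X a b) 1

theorem not_sameCycle_swap_mul [Finite α] {f : Perm α} {a b : α} (hab : a ≠ b) (h : cyc f a b) :
    ¬ cyc (swap a b * f) a b := by
  classical
  obtain ⟨n₀, hn₀⟩ := (SameCycle.exists_pow_eq'' h).imp fun n hn => hn.2.2
  have hex : ∃ n : ℕ, (f ^ n) a = b := ⟨n₀, hn₀⟩
  set m := Nat.find hex with hm
  have hmb : (f ^ m) a = b := Nat.find_spec hex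
  have hmin : ∀ k < m, (f ^ k) a ≠ b := fun k hk => Nat.find_min hex hk
  have hm0 : 0 < m := by
    rcases Nat.eq_zero_or_pos m with h0 | h0
    · rw [h0] at hmb
      exact absurd hmb hab
    · exact h0
  have hna : ∀ k, 0 < k → k ≤ m → (f ^ k) a ≠ a := by
    intro k hk hkm e
    refine hmin (m - k) (by omega) ?_
    rw [← hmb]
    conv_rhs => rw [← Nat.sub_add_cancel hkm, pow_add, mul_apply, e]
  -- With `m` the first time the orbit of `a` reaches `b`, the arc from `a` up to just before `b` is
  -- stable under `swap a b * f`: its last point now returns to `a`. This arc separates `a` from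
  -- `b`.
  let s : Setoid α := Setoid.ker fun x => ∃ k < m, (f ^ k) a = x
  have hle : cyc (swap a b * f) ≤ s := by
    refine cyc_le fun x => ?_
    change (∃ k < m, (f ^ k) a = x) = (∃ k < m, (f ^ k) a = (swap a b * f) x)
    rw [eq_iff_iff]
    constructor
    · rintro ⟨k, hk, rfl⟩
      rw [mul_apply, ← mul_apply f, ← pow_succ']
      rcases eq_or_lt_of_le (Nat.succ_le_of_lt hk) with e | hlt
      · refine ⟨0, hm0, ?_⟩
        rw [show k + 1 = m from e, hmb, swap_apply_right]
        rfl
      · exact ⟨k + 1, hlt, (swap_apply_of_ne_of_ne (hna _ k.succ_pos hlt.le) (hmin _ hlt)).symm⟩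
    · rintro ⟨k, hk, hkx⟩
      rw [mul_apply] at hkx
      rcases Nat.eq_zero_or_pos k with rfl | hk0
      · have : f x = b := by
          rw [← swap_apply_self a b (f x), ← hkx, pow_zero, one_apply, swap_apply_left]
        refine ⟨m - 1, by omega, f.injective ?_⟩
        rw [this, ← mul_apply, ← pow_succ', Nat.sub_add_cancel hm0, hmb]
      · have : f x = (f ^ k) a := by
          rw [← swap_apply_of_ne_of_ne (hna k hk0 hk.le) (hmin k hk), hkx, swap_apply_self]
        refine ⟨k - 1, by omega, f.injective ?_⟩
        rw [this, ← mul_apply, ← pow_succ', Nat.sub_add_cancel hk0]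
  intro hcyc
  have : (∃ k < m, (f ^ k) a = a) = (∃ k < m, (f ^ k) a = b) := hle hcyc
  obtain ⟨k, hk, e⟩ := this.mp ⟨0, hm0, rfl⟩
  exact hmin k hk e

theorem classCard_cyc_swap_mul_of_sameCycle [Finite α] {f : Perm α} {a b : α} (hab : a ≠ b)
    (h : cyc f a b) : (cyc (swap a b * f)).classCard = (cyc f).classCard + 1 := by
  rw [← Setoid.classCard_link (not_sameCycle_swap_mul hab h), link_cyc_swap_mul,
    Setoid.link_eq_self h]

end Equiv.Perm

/-- A partial equivalence of a finite type extends to a permutation such that no cycle contains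
two points at which the partial equivalence is undefined. -/
theorem PEquiv.exists_perm_extension {α : Type*} [Finite α] (f : α ≃. α) :
    ∃ τ : Equiv.Perm α, (∀ x y, y ∈ f x → τ x = y) ∧
      ∀ x ∈ {x | f x = none}, ∀ y ∈ {x | f x = none}, Equiv.Perm.cyc τ x y → x = y := by
  classical
  have := Fintype.ofFinite α
  let e : {x // (f x).isSome} ≃ {y // (f.symm y).isSome} :=
    { toFun := fun x => ⟨(f x).get x.2, Option.isSome_iff_exists.2
        ⟨x, f.mem_iff_mem.2 (Option.get_mem x.2)⟩⟩
      invFun := fun y => ⟨(f.symm y).get y.2, Option.isSome_iff_exists.2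
        ⟨y, f.mem_iff_mem.1 (Option.get_mem y.2)⟩⟩
      left_inv := fun x => Subtype.ext (Option.get_of_mem _ (f.mem_iff_mem.2 (Option.get_mem x.2)))
      right_inv := fun y =>
        Subtype.ext (Option.get_of_mem _ (f.mem_iff_mem.1 (Option.get_mem y.2))) }
  have hne : {τ : Equiv.Perm α | ∀ x y, y ∈ f x → τ x = y}.Nonempty := by
    refine ⟨e.extendSubtype, fun x y hy => ?_⟩
    rw [e.extendSubtype_apply_of_mem x (Option.isSome_iff_exists.2 ⟨y, hy⟩)]
    exact Option.get_of_mem _ hy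
  -- Take an extension with the most cycles. Were two undefined points on one cycle, exchanging
  -- their images, which are unconstrained, would split it.
  obtain ⟨τ, hτ, hmax⟩ := Set.exists_max_image {τ : Equiv.Perm α | ∀ x y, y ∈ f x → τ x = y}
    (fun τ => (Equiv.Perm.cyc τ).classCard) (Set.toFinite _) hne
  refine ⟨τ, hτ, fun x hx y hy hxy => ?_⟩
  by_contra hne
  have hxy' : Equiv.Perm.cyc τ (τ x) (τ y) :=
    Setoid.trans' _ (Setoid.symm' _ (Equiv.Perm.cyc_apply τ x))
      (Setoid.trans' _ hxy (Equiv.Perm.cyc_apply τ y))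
  have h := hmax (Equiv.swap (τ x) (τ y) * τ) fun z w hw => by
    have hzx : z ≠ x := by
      rintro rfl
      rw [show f z = none from hx] at hw
      cases hw
    have hzy : z ≠ y := by
      rintro rfl
      rw [show f z = none from hy] at hw
      cases hw
    rw [Equiv.Perm.mul_apply, Equiv.swap_apply_of_ne_of_ne (τ.injective.ne hzx)
      (τ.injective.ne hzy)]
    exact hτ z w hw
  rw [Equiv.Perm.classCard_cyc_swap_mul_of_sameCycle (τ.injective.ne hne) hxy'] at h
  omega

/-! ### Counting the closed faces of a family of commuting reconnections -/

namespace Equiv.Perm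

open Classical in
/-- The involution of `V × Bool` that exchanges the two points above each element of `S`. -/
noncomputable def toggle {V : Type*} (S : Set V) : Perm (V × Bool) :=
  Function.Involutive.toPerm (fun p => if p.1 ∈ S then (p.1, !p.2) else p) fun p => by
    by_cases h : p.1 ∈ S <;> simp [h]

variable {V : Type*} {S : Set V}

theorem toggle_of_mem {p : V × Bool} (h : p.1 ∈ S) : toggle S p = (p.1, !p.2) := if_pos h

theorem toggle_of_notMem {p : V × Bool} (h : p.1 ∉ S) : toggle S p = p := if_neg h

theorem toggle_toggle (p : V × Bool) : toggle S (toggle S p) = p :=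
  (toggle S).left_inv p

theorem toggle_empty : toggle (∅ : Set V) = 1 :=
  Equiv.ext fun _ => toggle_of_notMem (Set.notMem_empty _)

open Classical in
theorem toggle_insert {v : V} (h : v ∉ S) :
    toggle (insert v S) = swap (v, false) (v, true) * toggle S := by
  ext1 ⟨u, s⟩
  rw [mul_apply]
  by_cases hu : u = v
  · subst hu
    rw [toggle_of_mem (p := (u, s)) (Set.mem_insert _ _), toggle_of_notMem h]
    cases s
    · exact (swap_apply_left _ _).symm
    · exact (swap_apply_right _ _).symm
  · have hne : ∀ t t' : Bool, (u, t) ≠ (v, t') := fun t t' e => hu (congrArg Prod.fst e)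
    by_cases hS : u ∈ S
    · rw [toggle_of_mem (Set.mem_insert_of_mem v hS), toggle_of_mem hS,
        swap_apply_of_ne_of_ne (hne _ _) (hne _ _)]
    · rw [toggle_of_notMem (S := S) hS, toggle_of_notMem (by simp [hu, hS]),
        swap_apply_of_ne_of_ne (hne _ _) (hne _ _)]

/-- The equivalence relation generated by a permutation of `V × Bool` and by the exchange of the two
points above each element of `S`. -/
def joined (τ : Perm (V × Bool)) (S : Set V) : Setoid (V × Bool) :=
  Relation.EqvGen.setoid fun p q => q = τ p ∨ p.1 ∈ S ∧ q = (p.1, !p.2)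

variable {τ : Perm (V × Bool)}

theorem joined_apply (p : V × Bool) : joined τ S p (τ p) := Relation.EqvGen.rel _ _ (Or.inl rfl)

theorem joined_not {v : V} (h : v ∈ S) (s : Bool) : joined τ S (v, s) (v, !s) :=
  Relation.EqvGen.rel _ _ (Or.inr ⟨h, rfl⟩)

theorem joined_le {r : Setoid (V × Bool)} (h : ∀ p, r p (τ p))
    (h' : ∀ v ∈ S, r (v, false) (v, true)) : joined τ S ≤ r := by
  refine Setoid.eqvGen_le ?_
  rintro ⟨v, s⟩ q (rfl | ⟨hv, rfl⟩)
  · exact h _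
  · cases s
    · exact h' v hv
    · exact r.symm (h' v hv)

theorem joined_mono {S' : Set V} (h : S ⊆ S') : joined τ S ≤ joined τ S' :=
  joined_le joined_apply fun _ hv => joined_not (h hv) false

theorem cyc_le_joined : cyc τ ≤ joined τ S := cyc_le joined_apply

theorem joined_empty : joined τ (∅ : Set V) = cyc τ :=
  le_antisymm (joined_le (cyc_apply τ) fun _ h => h.elim) cyc_le_joined

theorem joined_insert (v : V) :
    joined τ (insert v S) = (joined τ S).link (v, false) (v, true) := by
  refine le_antisymm (joined_le (fun p => Setoid.le_link _ _ _ (joined_apply p)) ?_)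
    (Setoid.link_le (joined_mono (Set.subset_insert v S))
      (joined_not (Set.mem_insert v S) false))
  rintro u (rfl | hu)
  · exact Setoid.link_rel _ _ _
  · exact Setoid.le_link _ _ _ (joined_not hu false)

/-- `joined` ignores colours, so points that it separates lie on different cycles for every colour,
and a cycle meeting `X` lies in a component meeting `X`. -/
theorem cyc_toggle_mul_le_joined {S' : Set V} (h : S' ⊆ S) : cyc (toggle S' * τ) ≤ joined τ S := by
  refine cyc_le fun p => Setoid.trans' _ (joined_apply p) ?_
  rw [mul_apply]
  by_cases hp : (τ p).1 ∈ S'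
  · rw [toggle_of_mem hp]
    exact joined_not (h hp) _
  · rw [toggle_of_notMem hp]

/-! ### Closed cycles of each colour as bubbles are switched on. -/

variable {ι : Type*} (col : V → ι) (X : Set (V × Bool))

/-- The number of cycles of colour `i` that avoid `X`, when the elements of `S` are switched on. -/
noncomputable def closedCount (τ : Perm (V × Bool)) (S : Set V) (i : ι) : ℕ :=
  (cyc (toggle {v | v ∈ S ∧ col v = i} * τ)).avoidCard X

theorem closedCount_insert_of_ne {v : V} {i : ι} (h : col v ≠ i) :
    closedCount col X τ (insert v S) i = closedCount col X τ S i := by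
  have : {u | u ∈ insert v S ∧ col u = i} = {u | u ∈ S ∧ col u = i} := by
    ext u
    simp only [Set.mem_insert_iff, Set.mem_ofPred_eq]
    constructor
    · rintro ⟨rfl | hu, hi⟩
      · exact absurd hi h
      · exact ⟨hu, hi⟩
    · exact fun hu => ⟨Or.inr hu.1, hu.2⟩
  rw [closedCount, this, closedCount]

open Classical in
theorem closedCount_insert_self {v : V} (h : v ∉ S) :
    closedCount col X τ (insert v S) (col v) =
      (cyc (swap (v, false) (v, true) *
        (toggle {u | u ∈ S ∧ col u = col v} * τ))).avoidCard X := by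
  have : {u | u ∈ insert v S ∧ col u = col v} = insert v {u | u ∈ S ∧ col u = col v} := by
    ext u
    simp only [Set.mem_insert_iff, Set.mem_ofPred_eq]
    constructor
    · rintro ⟨rfl | hu, hi⟩
      · exact Or.inl rfl
      · exact Or.inr ⟨hu, hi⟩
    · rintro (rfl | hu)
      · exact ⟨Or.inl rfl, rfl⟩
      · exact ⟨Or.inr hu.1, hu.2⟩
  rw [closedCount, this, toggle_insert fun hv => h hv.1, mul_assoc]

theorem closedCount_insert_le [Finite V] {v : V} (h : v ∉ S) :
    closedCount col X τ (insert v S) (col v) ≤ closedCount col X τ S (col v) + 1 := by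
  classical
  rw [closedCount_insert_self col X h]
  exact avoidCard_cyc_swap_mul_le _ X _ _

theorem closedCount_insert_le_of_not [Finite V] {v : V} (h : v ∉ S)
    (hv : ¬ joined τ S (v, false) (v, true)) :
    closedCount col X τ (insert v S) (col v) ≤ closedCount col X τ S (col v) := by
  classical
  rw [closedCount_insert_self col X h, cyc_swap_mul_of_not
    fun hc => hv (cyc_toggle_mul_le_joined (fun _ hu => hu.1) hc)]
  exact Setoid.avoidCard_link_le _ X _ _

theorem closedCount_insert_of_not_meets [Finite V] {v : V} (h : v ∉ S)
    (hv : ¬ joined τ S (v, false) (v, true))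
    (hX : ¬ ((cyc (toggle {u | u ∈ S ∧ col u = col v} * τ)).Meets X (v, false) ∧
      (cyc (toggle {u | u ∈ S ∧ col u = col v} * τ)).Meets X (v, true))) :
    closedCount col X τ (insert v S) (col v) + 1 = closedCount col X τ S (col v) := by
  classical
  have hc : ¬ cyc (toggle {u | u ∈ S ∧ col u = col v} * τ) (v, false) (v, true) :=
    fun hc => hv (cyc_toggle_mul_le_joined (fun _ hu => hu.1) hc)
  rw [closedCount_insert_self col X h, cyc_swap_mul_of_not hc]
  exact Setoid.avoidCard_link_of_not_meets hc hX

theorem joined_coe_insert [DecidableEq V] (E : Finset V) (v : V) :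
    joined τ ((insert v E : Finset V) : Set V) =
      (joined τ (E : Set V)).link (v, false) (v, true) := by
  rw [Finset.coe_insert, joined_insert]

variable [Fintype ι]

open Classical in
theorem sum_closedCount_insert (S : Set V) (v : V) :
    ((∑ i, closedCount col X τ (insert v S) i : ℕ) : ℤ) - (∑ i, closedCount col X τ S i : ℕ) =
      closedCount col X τ (insert v S) (col v) - closedCount col X τ S (col v) := by
  rw [← Finset.add_sum_erase _ _ (Finset.mem_univ (col v)),
    ← Finset.add_sum_erase _ (closedCount col X τ S) (Finset.mem_univ (col v)),
    Finset.sum_congr rfl fun i hi =>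
      closedCount_insert_of_ne col X (S := S) (τ := τ) (Finset.ne_of_mem_erase hi).symm]
  push_cast
  ring

/-- The number of elements switched on plus the number of connected components. -/
noncomputable def cyclomatic (τ : Perm (V × Bool)) (E : Finset V) : ℕ :=
  E.card + (joined τ (E : Set V)).classCard

/-- The amount by which the number of closed cycles stays below the bound obtained by switching on
the elements of `E` one after the other. -/
noncomputable def defect (τ : Perm (V × Bool)) (E : Finset V) : ℤ :=
  (joined τ (E : Set V)).avoidCard X + cyclomatic τ E -
    (∑ i, closedCount col X τ (E : Set V) i : ℕ)

theorem cyclomatic_empty (τ : Perm (V × Bool)) : cyclomatic τ ∅ = (cyc τ).classCard := by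
  rw [cyclomatic, Finset.coe_empty, joined_empty, Finset.card_empty, zero_add]

theorem defect_empty (τ : Perm (V × Bool)) :
    defect col X τ ∅ =
      (cyc τ).avoidCard X + (cyc τ).classCard - Fintype.card ι * (cyc τ).avoidCard X := by
  have : ∀ i, closedCount col X τ (∅ : Set V) i = (cyc τ).avoidCard X := by
    intro i
    rw [closedCount, show {v | v ∈ (∅ : Set V) ∧ col v = i} = ∅ by ext; simp, toggle_empty, one_mul]
  rw [defect, cyclomatic_empty, Finset.coe_empty, joined_empty]
  simp [this]

variable [DecidableEq V]

theorem cyclomatic_insert_of_joined {E : Finset V} {v : V} (hv : v ∉ E)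
    (h : joined τ (E : Set V) (v, false) (v, true)) :
    cyclomatic τ (insert v E) = cyclomatic τ E + 1 := by
  rw [cyclomatic, cyclomatic, joined_coe_insert, Setoid.link_eq_self h,
    Finset.card_insert_of_notMem hv]
  omega

theorem cyclomatic_insert_of_not_joined [Finite V] {E : Finset V} {v : V} (hv : v ∉ E)
    (h : ¬ joined τ (E : Set V) (v, false) (v, true)) :
    cyclomatic τ (insert v E) = cyclomatic τ E := by
  have := Setoid.classCard_link h
  rw [cyclomatic, cyclomatic, joined_coe_insert, Finset.card_insert_of_notMem hv]
  omega

theorem cyclomatic_mono [Finite V] (τ : Perm (V × Bool)) : Monotone (cyclomatic τ) := by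
  refine Finset.monotone_iff_forall_le_insert.2 fun E v hv => ?_
  by_cases h : joined τ (E : Set V) (v, false) (v, true)
  · rw [cyclomatic_insert_of_joined hv h]
    exact Nat.le_succ _
  · rw [cyclomatic_insert_of_not_joined hv h]

theorem defect_insert (E : Finset V) (v : V) :
    defect col X τ (insert v E) - defect col X τ E =
      ((joined τ ((insert v E : Finset V) : Set V)).avoidCard X -
          (joined τ (E : Set V)).avoidCard X : ℤ) +
        (cyclomatic τ (insert v E) - cyclomatic τ E : ℤ) -
        (closedCount col X τ (insert v (E : Set V)) (col v) -
          closedCount col X τ (E : Set V) (col v)) := by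
  rw [← sum_closedCount_insert, defect, defect, Finset.coe_insert]
  ring

/-- An edge inside a component raises `cyclomatic` by one and the closed cycles by at most one. An
edge between two components leaves `cyclomatic` unchanged: if both components meet `X`, the closed
cycles cannot increase; otherwise one avoiding component and one closed cycle disappear together,
and the defect is unchanged. -/
theorem defect_mono [Finite V] (τ : Perm (V × Bool)) : Monotone (defect col X τ) := by
  refine Finset.monotone_iff_forall_le_insert.2 fun E v hv => ?_
  have hv' : v ∉ (E : Set V) := hv
  have hd := defect_insert (τ := τ) col X E v
  rw [joined_coe_insert] at hd
  by_cases h : joined τ (E : Set V) (v, false) (v, true)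
  · rw [Setoid.link_eq_self h, cyclomatic_insert_of_joined hv h] at hd
    have := closedCount_insert_le (τ := τ) col X hv'
    push_cast at hd
    omega
  · rw [cyclomatic_insert_of_not_joined hv h] at hd
    by_cases hX : (joined τ (E : Set V)).Meets X (v, false) ∧
        (joined τ (E : Set V)).Meets X (v, true)
    · have := closedCount_insert_le_of_not col X hv' h
      rw [Setoid.avoidCard_link_of_meets h hX.1 hX.2] at hd
      omega
    · have h1 := Setoid.avoidCard_link_of_not_meets h hX
      have h2 := closedCount_insert_of_not_meets col X hv' h fun hc =>
        hX ⟨hc.1.mono (cyc_toggle_mul_le_joined fun _ hu => hu.1),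
          hc.2.mono (cyc_toggle_mul_le_joined fun _ hu => hu.1)⟩
      omega

/-- If switching on `v` joins two components that both meet `X` without increasing the defect, then
both of the cycles of colour `col v` that are joined meet `X`. -/
theorem meets_of_defect_insert_eq [Finite V] {E : Finset V} {v : V} (hv : v ∉ E)
    (h : ¬ joined τ (E : Set V) (v, false) (v, true))
    (hX : ∀ s, (joined τ (E : Set V)).Meets X (v, s))
    (hd : defect col X τ (insert v E) = defect col X τ E) (s : Bool) :
    (cyc (toggle {u | u ∈ E ∧ col u = col v} * τ)).Meets X (v, s) := by
  have hd' := defect_insert (τ := τ) col X E v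
  rw [joined_coe_insert, cyclomatic_insert_of_not_joined hv h,
    Setoid.avoidCard_link_of_meets h (hX _) (hX _), hd] at hd'
  by_contra hs
  have := closedCount_insert_of_not_meets col X (S := E) hv h fun hc => by
    cases s
    · exact hs hc.1
    · exact hs hc.2
  omega

end Equiv.Perm

/-! ### Faces of a diagram as cycles of permutations -/

theorem SimpleGraph.Reachable.rel {α : Type*} {H : SimpleGraph α} (s : Setoid α)
    (h : ∀ x y, H.Adj x y → s x y) {x y : α} (hxy : H.Reachable x y) : s x y := by
  obtain ⟨p⟩ := hxy
  induction p with
  | nil => exact s.refl _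
  | cons hadj _ ih => exact s.trans (h _ _ hadj) ih

theorem Set.ncard_sigma_eq_sum {ι : Type*} [Fintype ι] {β : ι → Type*} [∀ i, Finite (β i)]
    (p : (Σ i, β i) → Prop) : {f | p f}.ncard = ∑ i, {b | p ⟨i, b⟩}.ncard := by
  let e : {f // p f} ≃ Σ i, {b : β i // p ⟨i, b⟩} :=
    { toFun := fun f => ⟨f.1.1, f.1.2, f.2⟩
      invFun := fun g => ⟨⟨g.1, g.2.1⟩, g.2.2⟩
      left_inv := fun _ => rfl
      right_inv := fun _ => rfl }
  have h := Nat.card_congr e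
  rw [Nat.card_sigma] at h
  exact h

namespace QuarticDiagram

open Equiv.Perm

variable {d : ℕ} {V : Type*} (G : QuarticDiagram d V)

/-- The white nodes hooked to an external edge. -/
def whiteExternal : Set (V × Bool) := {w | G.line w = none}

theorem exists_mem_line {w : V × Bool} (h : w ∉ G.whiteExternal) : ∃ b, b ∈ G.line w :=
  Option.ne_none_iff_exists'.1 h

theorem internalEdges_eq : G.internalEdges = G.whiteExternalᶜ := by
  ext w
  simp [internalEdges, whiteExternal, Option.isSome_iff_ne_none]

/-- The exchange of the two points above each vertex of colour `i`. -/
noncomputable abbrev colourToggle (i : Fin d) : Equiv.Perm (V × Bool) := toggle {v | G.colour v = i}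

theorem bubbleEdge_eq (i : Fin d) (w : V × Bool) : G.bubbleEdge i w = G.colourToggle i w := by
  by_cases h : i = G.colour w.1
  · rw [bubbleEdge, if_pos h, toggle_of_mem h.symm]
  · rw [bubbleEdge, if_neg h, toggle_of_notMem (fun e : G.colour w.1 = i => h e.symm)]

theorem reachable_bubble (i : Fin d) (w : V × Bool) :
    (G.stranded i).Reachable (Sum.inl w) (Sum.inr (G.colourToggle i w)) :=
  SimpleGraph.Adj.reachable ⟨Sum.inl_ne_inr, Or.inl ⟨w, _, rfl, rfl, Or.inl (G.bubbleEdge_eq i w)⟩⟩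

theorem reachable_line (i : Fin d) {w b : V × Bool} (h : b ∈ G.line w) :
    (G.stranded i).Reachable (Sum.inl w) (Sum.inr b) :=
  SimpleGraph.Adj.reachable ⟨Sum.inl_ne_inr, Or.inl ⟨w, _, rfl, rfl, Or.inr h⟩⟩

theorem rel_of_reachable {i : Fin d} (s : Setoid (Node V))
    (h : ∀ w, s (Sum.inl w) (Sum.inr (G.colourToggle i w)))
    (h' : ∀ w, ∀ b ∈ G.line w, s (Sum.inl w) (Sum.inr b)) {x y : Node V}
    (hxy : (G.stranded i).Reachable x y) : s x y := by
  have key : ∀ x y : Node V, (∃ w b, x = Sum.inl w ∧ y = Sum.inr b ∧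
      (G.bubbleEdge i w = b ∨ b ∈ G.line w)) → s x y := by
    rintro x y ⟨w, b, rfl, rfl, hb | hb⟩
    · rw [← hb, bubbleEdge_eq]
      exact h w
    · exact h' w b hb
  refine hxy.rel s ?_
  rintro x y ⟨-, hadj | hadj⟩
  · exact key x y hadj
  · exact s.symm (key y x hadj)

/-- The white end of the edge of colour `i` at a node. -/
noncomputable def whiteEnd (i : Fin d) : Node V → V × Bool
  | Sum.inl w => w
  | Sum.inr b => G.colourToggle i b

theorem reachable_whiteEnd (i : Fin d) (x : Node V) :
    (G.stranded i).Reachable x (Sum.inl (G.whiteEnd i x)) := by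
  obtain w | b := x
  · exact SimpleGraph.Reachable.refl _
  · have := G.reachable_bubble i (G.colourToggle i b)
    rw [toggle_toggle] at this
    exact this.symm

theorem reachable_succ (i : Fin d) {w b : V × Bool} (h : b ∈ G.line w) :
    (G.stranded i).Reachable (Sum.inl w) (Sum.inl (G.colourToggle i b)) :=
  (G.reachable_line i h).trans (G.reachable_whiteEnd i (Sum.inr b))

section Extension

variable {G} {τ : Equiv.Perm (V × Bool)} (hτ : ∀ x y, y ∈ G.line x → τ x = y)
include hτ

theorem sameCycle_whiteEnd {i : Fin d} {x y : Node V} (h : (G.stranded i).Reachable x y) :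
    cyc (G.colourToggle i * τ) (G.whiteEnd i x) (G.whiteEnd i y) := by
  refine G.rel_of_reachable ((cyc (G.colourToggle i * τ)).comap (G.whiteEnd i)) ?_ ?_ h
  · intro w
    rw [Setoid.comap_rel, whiteEnd, whiteEnd, toggle_toggle]
  · intro w b hb
    rw [Setoid.comap_rel, whiteEnd, whiteEnd, ← hτ w b hb]
    exact cyc_apply _ w

variable [Finite V]

/-- The values of `τ` that are not propagators are taken only on `G.whiteExternal`, which this face
never visits. -/
theorem reachable_of_sameCycle {i : Fin d} {w w' : V × Bool}
    (hw : ∀ z ∈ G.whiteExternal, ¬ (G.stranded i).Reachable (Sum.inl w) (Sum.inl z))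
    (h : cyc (G.colourToggle i * τ) w w') : (G.stranded i).Reachable (Sum.inl w) (Sum.inl w') := by
  obtain ⟨n, rfl⟩ := SameCycle.exists_nat_pow_eq h
  clear h
  induction n with
  | zero => exact SimpleGraph.Reachable.refl _
  | succ n ih =>
    obtain ⟨b, hb⟩ := G.exists_mem_line fun hz => hw _ hz ih
    rw [pow_succ', mul_apply, mul_apply, hτ _ b hb]
    exact ih.trans (G.reachable_succ i hb)

/-- A face that contains no white node hooked to an external edge contains no black one either. -/
theorem isExternal_iff (f : G.Face) :
    f.IsExternal ↔ ∃ w ∈ G.whiteExternal, Sum.inl w ∈ f.nodes := by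
  refine ⟨?_, fun ⟨w, hw, hf⟩ => ⟨_, hf, hw⟩⟩
  obtain ⟨i, C⟩ := f
  rintro ⟨w | b, hx, hext⟩
  · exact ⟨w, hext, hx⟩
  by_contra! hcon
  have hCb : (G.stranded i).connectedComponentMk (Sum.inr b) = C := hx
  have hb := G.reachable_whiteEnd i (Sum.inr b)
  have hmem : ∀ z, (G.stranded i).Reachable (Sum.inr b) (Sum.inl z) → z ∉ G.whiteExternal := by
    intro z hz hz'
    exact hcon z hz' (hCb ▸ SimpleGraph.ConnectedComponent.sound hz.symm)
  set w := τ⁻¹ b with hw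
  have hτw : τ w = b := τ.apply_symm_apply b
  have hcyc : cyc (G.colourToggle i * τ) (G.colourToggle i b) w := by
    refine Setoid.symm' _ ?_
    have := cyc_apply (G.colourToggle i * τ) w
    rwa [mul_apply, hτw] at this
  have hr := hb.trans (reachable_of_sameCycle hτ
    (fun z hz hz' => hmem z (hb.trans hz') hz) hcyc)
  obtain ⟨b', hb'⟩ := G.exists_mem_line (hmem w hr)
  have : b' = b := (hτ w b' hb').symm.trans hτw
  rw [this, ← G.line.mem_iff_mem] at hb'
  rw [show G.line.symm b = none from hext] at hb'
  cases hb'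

theorem ncard_closed_components (i : Fin d) :
    {C | ¬ Face.IsExternal (G := G) ⟨i, C⟩}.ncard =
      (cyc (G.colourToggle i * τ)).avoidCard G.whiteExternal := by
  let g : (G.stranded i).ConnectedComponent → Quotient (cyc (G.colourToggle i * τ)) :=
    Quot.map (G.whiteEnd i) fun x y h => sameCycle_whiteEnd hτ h
  have hg : ∀ x, g ((G.stranded i).connectedComponentMk x) = Quotient.mk _ (G.whiteEnd i x) :=
    fun _ => rfl
  have hrep : ∀ C : (G.stranded i).ConnectedComponent,
      ∃ w, (G.stranded i).connectedComponentMk (Sum.inl w) = C := by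
    intro C
    induction C using SimpleGraph.ConnectedComponent.ind with | _ x
    exact ⟨G.whiteEnd i x, SimpleGraph.ConnectedComponent.sound (G.reachable_whiteEnd i x).symm⟩
  have hclosed : ∀ w, ¬ Face.IsExternal (G := G)
      ⟨i, (G.stranded i).connectedComponentMk (Sum.inl w)⟩ ↔
        ∀ z ∈ G.whiteExternal, ¬ (G.stranded i).Reachable (Sum.inl w) (Sum.inl z) := by
    intro w
    rw [isExternal_iff hτ]
    push Not
    refine forall₂_congr fun z _ => not_congr ?_
    exact SimpleGraph.ConnectedComponent.eq.trans SimpleGraph.reachable_comm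
  refine Set.BijOn.ncard_eq (f := g) ⟨?_, ?_, ?_⟩
  · intro C hC
    obtain ⟨w, rfl⟩ := hrep C
    rw [hg, Setoid.mk_mem_avoiding]
    rintro ⟨z, hz, hzw⟩
    exact (hclosed w).1 hC z hz
      (reachable_of_sameCycle hτ ((hclosed w).1 hC) (Setoid.symm' _ hzw))
  · intro C hC C' hC' h
    obtain ⟨w, rfl⟩ := hrep C
    obtain ⟨w', rfl⟩ := hrep C'
    rw [hg, hg, Quotient.eq] at h
    exact SimpleGraph.ConnectedComponent.sound
      (reachable_of_sameCycle hτ ((hclosed w).1 hC) h)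
  · intro q hq
    induction q using Quotient.inductionOn with | _ w
    rw [Setoid.mk_mem_avoiding] at hq
    refine ⟨(G.stranded i).connectedComponentMk (Sum.inl w), (hclosed w).2 fun z hz hz' => ?_, hg _⟩
    exact hq ⟨z, hz, Setoid.symm' _ (sameCycle_whiteEnd hτ hz')⟩

theorem ncard_internalFaces :
    G.internalFaces.ncard = ∑ i, closedCount G.colour G.whiteExternal τ Set.univ i := by
  rw [internalFaces, Set.ncard_sigma_eq_sum]
  refine Finset.sum_congr rfl fun i _ => ?_
  rw [ncard_closed_components hτ, closedCount]
  simp only [Set.mem_univ, true_and]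

end Extension

/-- If the diagram remains connected after the deletion of the internal edges in `S`, then every
permutation that extends the remaining internal edges joins all the points. -/
theorem joined_of_connected {G : QuarticDiagram d V} {τ : Equiv.Perm (V × Bool)}
    {S : Set (V × Bool)} (hG : (G.vertexGraph S).Connected)
    (hτ : ∀ x y, x ∉ S → y ∈ G.line x → τ x = y) (p q : V × Bool) :
    joined τ Set.univ p q := by
  have hbase : ∀ p : V × Bool, joined τ Set.univ p (p.1, false) := by
    rintro ⟨v, s⟩
    cases s
    · exact Setoid.refl' _ _
    · exact joined_not (Set.mem_univ v) true
  have key : ∀ u v, (∃ s t, (u, s) ∉ S ∧ (v, t) ∈ G.line (u, s)) →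
      joined τ Set.univ (u, false) (v, false) := by
    rintro u v ⟨s, t, hS, hst⟩
    have h := joined_apply (S := Set.univ) (τ := τ) (u, s)
    rw [hτ _ _ hS hst] at h
    exact Setoid.trans' _ (Setoid.symm' _ (hbase (u, s))) (Setoid.trans' _ h (hbase (v, t)))
  refine Setoid.trans' _ (hbase p) (Setoid.trans' _ ?_ (Setoid.symm' _ (hbase q)))
  refine (hG.preconnected p.1 q.1).rel ((joined τ Set.univ).comap fun v => (v, false)) ?_
  rintro u v ⟨-, h | h⟩
  · exact key u v h
  · exact Setoid.symm' _ (key v u h)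

end QuarticDiagram

/-! ### Melonic diagrams -/

namespace QuarticDiagram

open Equiv.Perm

variable {d : ℕ} {V : Type*} {G : QuarticDiagram d V} {τ : Equiv.Perm (V × Bool)}

/-- In a melonic diagram, the bounds on the number of closed cycles are saturated at every stage. -/
theorem IsMelonic.cyclomatic_and_defect [Fintype V] (hd : 3 ≤ d) (hmel : G.IsMelonic)
    (hX : G.whiteExternal.Nonempty) (hτ : ∀ x y, y ∈ G.line x → τ x = y)
    (hsep : ∀ x ∈ G.whiteExternal, ∀ y ∈ G.whiteExternal, cyc τ x y → x = y) (E : Finset V) :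
    cyclomatic τ E = Fintype.card V + 1 ∧
      defect G.colour G.whiteExternal τ E = defect G.colour G.whiteExternal τ ∅ := by
  classical
  obtain ⟨x₀, hx₀⟩ := hX
  have hconn : ∀ p q, joined τ Set.univ p q :=
    joined_of_connected hmel.1 fun x y _ => hτ x y
  have : Nonempty (V × Bool) := ⟨x₀⟩
  have hcu : cyclomatic τ Finset.univ = Fintype.card V + 1 := by
    rw [cyclomatic, Finset.coe_univ, Setoid.classCard_eq_one hconn, Finset.card_univ]
  have hF := hmel.2
  rw [ncard_internalFaces hτ] at hF
  have hdu : defect G.colour G.whiteExternal τ Finset.univ = Fintype.card V + 1 -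
      ((d : ℤ) - 1) * ((G.internalEdges.ncard : ℤ) - Fintype.card V + 1) := by
    rw [defect, hcu, Finset.coe_univ,
      Setoid.avoidCard_eq_zero fun a => ⟨x₀, hx₀, hconn x₀ a⟩, hF]
    push_cast
    ring
  have hd0 := defect_empty G.colour G.whiteExternal τ
  rw [Fintype.card_fin] at hd0
  have hc0 := cyclomatic_empty τ
  have hK := Setoid.avoidCard_add_ncard hsep
  have hL : G.whiteExternal.ncard + G.internalEdges.ncard = 2 * Fintype.card V := by
    rw [internalEdges_eq, Set.ncard_add_ncard_compl, Nat.card_eq_fintype_card, Fintype.card_prod,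
      Fintype.card_bool, mul_comm]
  have hcle := cyclomatic_mono τ (Finset.subset_univ (∅ : Finset V))
  have hdle := defect_mono G.colour G.whiteExternal τ (Finset.subset_univ (∅ : Finset V))
  rw [hcu, hc0] at hcle
  rw [hdu, hd0] at hdle
  have hLz : (G.internalEdges.ncard : ℤ) = 2 * Fintype.card V - G.whiteExternal.ncard := by
    omega
  have hKz : ((cyc τ).classCard : ℤ) =
      (cyc τ).avoidCard G.whiteExternal + G.whiteExternal.ncard := by
    rw [← hK]
    push_cast
    ring
  have hdz : (3 : ℤ) ≤ d := by exact_mod_cast hd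
  have hclez : ((cyc τ).classCard : ℤ) ≤ Fintype.card V + 1 := by exact_mod_cast hcle
  -- After substitution `hdle` reads (d - 2)(V + 1 - K) ≤ 0 with K the number of cycles, while
  -- `hclez` gives K ≤ V + 1; this is where d ≥ 3 enters.
  have hKV : ((cyc τ).classCard : ℤ) = Fintype.card V + 1 := by
    rw [hLz] at hdle
    nlinarith
  have hcE : cyclomatic τ ∅ = Fintype.card V + 1 := by
    rw [hc0]
    exact_mod_cast hKV
  have hdE : defect G.colour G.whiteExternal τ Finset.univ =
      defect G.colour G.whiteExternal τ ∅ := by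
    have hV : (Fintype.card V : ℤ) =
        (cyc τ).avoidCard G.whiteExternal + G.whiteExternal.ncard - 1 := by omega
    rw [hdu, hd0, hLz, hKz, hV]
    ring
  constructor
  · refine le_antisymm ?_ ?_
    · rw [← hcu]
      exact cyclomatic_mono τ (Finset.subset_univ E)
    · rw [← hcE]
      exact cyclomatic_mono τ (Finset.empty_subset E)
  · refine le_antisymm ?_ (defect_mono _ _ τ (Finset.empty_subset E))
    rw [← hdE]
    exact defect_mono _ _ τ (Finset.subset_univ E)

/-- In a 1PI diagram, the open paths of propagators are trivial as soon as cutting any of them open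
would increase the number of components. -/
theorem IsOnePI.apply_eq_self [Fintype V] (hPI : G.IsOnePI)
    (hcyc : (cyc τ).classCard = Fintype.card V + 1) (hτ : ∀ x y, y ∈ G.line x → τ x = y)
    (hsep : ∀ x ∈ G.whiteExternal, ∀ y ∈ G.whiteExternal, cyc τ x y → x = y)
    {x : V × Bool} (hx : x ∈ G.whiteExternal) : τ x = x := by
  classical
  by_contra hne
  set y := τ⁻¹ x with hy
  have hτy : τ y = x := τ.apply_symm_apply x
  have hyx : y ≠ x := fun e => hne (by rw [← e, hτy, e])
  have hyX : y ∉ G.whiteExternal := by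
    intro h
    have := cyc_apply τ y
    rw [hτy] at this
    exact hyx (hsep y h x hx this)
  have hyL : y ∈ G.internalEdges := by
    rw [internalEdges_eq]
    exact hyX
  have hcard := classCard_cyc_swap_mul_of_sameCycle (Ne.symm hne) (cyc_apply τ x)
  -- `τ'` fixes `x` and sends `y` to `τ x`, so the propagator at `y` is the only one it breaks. It
  -- has V + 2 cycles, yet the V bubbles would still connect them all.
  set τ' := Equiv.swap x (τ x) * τ with hτ'
  have hconn : ∀ p q, joined τ' Set.univ p q := by
    refine joined_of_connected (hPI.2 y hyL) fun z b hz hb => ?_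
    have hzx : z ≠ x := by
      rintro rfl
      rw [show G.line z = none from hx] at hb
      cases hb
    rw [hτ', mul_apply, Equiv.swap_apply_of_ne_of_ne, hτ z b hb]
    · rw [← hτy]
      exact τ.injective.ne hz
    · exact τ.injective.ne hzx
  have : Nonempty (V × Bool) := ⟨x⟩
  have hle := cyclomatic_mono τ' (Finset.subset_univ (∅ : Finset V))
  rw [cyclomatic_empty, cyclomatic, Finset.coe_univ, Setoid.classCard_eq_one hconn,
    Finset.card_univ, hcard, hcyc] at hle
  omega

/-- A permutation fixing the external white labels permutes the others among themselves, and there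
it coincides with the propagators. -/
theorem isExternalNode_inr_iff (hτ : ∀ x y, y ∈ G.line x → τ x = y)
    (hfix : ∀ x ∈ G.whiteExternal, τ x = x) (b : V × Bool) :
    G.IsExternalNode (Sum.inr b) ↔ b ∈ G.whiteExternal := by
  change G.line.symm b = none ↔ _
  constructor
  · intro hb
    have hτb : τ (τ⁻¹ b) = b := τ.apply_symm_apply b
    by_cases h : τ⁻¹ b ∈ G.whiteExternal
    · have := hfix _ h
      rw [hτb] at this
      rwa [← this] at h
    · obtain ⟨b', hb'⟩ := G.exists_mem_line h
      rw [← hτ _ b' hb', ← G.line.mem_iff_mem, hτb, hb] at hb'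
      cases hb'
  · intro hb
    refine Option.eq_none_iff_forall_not_mem.2 fun y hy => ?_
    rw [G.line.mem_iff_mem] at hy
    have : y = b := τ.injective ((hτ y b hy).trans (hfix b hb).symm)
    rw [this, show G.line b = none from hb] at hy
    cases hy

/-! ### Diagrams whose external white and black nodes carry the same labels. -/

section Paired

variable (hext : ∀ b, G.IsExternalNode (Sum.inr b) ↔ b ∈ G.whiteExternal)
include hext

theorem notMem_line {x w : V × Bool} (hx : x ∈ G.whiteExternal) : x ∉ G.line w := by
  intro h
  rw [← G.line.mem_iff_mem, show G.line.symm x = none from (hext x).2 hx] at h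
  cases h

theorem IsConnected.not_mem_whiteExternal [Fintype V] (hG : G.IsConnected)
    (hV : 1 < Fintype.card V) {v : V} {s : Bool} (h : (v, s) ∈ G.whiteExternal) :
    (v, !s) ∉ G.whiteExternal := by
  intro h'
  have hv : ∀ t, (v, t) ∈ G.whiteExternal := by
    intro t
    rcases Bool.eq_or_eq_not t s with rfl | rfl
    · exact h
    · exact h'
  have key : ∀ a b : V, (∃ s t, (a, s) ∉ (∅ : Set (V × Bool)) ∧ (b, t) ∈ G.line (a, s)) →
      a ≠ v ∧ b ≠ v := by
    rintro a b ⟨s, t, -, hab⟩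
    constructor
    · rintro rfl
      rw [show G.line (a, s) = none from hv s] at hab
      cases hab
    · rintro rfl
      exact notMem_line hext (hv t) hab
  obtain ⟨u, hu⟩ := Fintype.exists_ne_of_one_lt_card hV v
  -- With both pairs of nodes external, `v` has no propagator and would be isolated.
  have := (hG.preconnected v u).rel (Setoid.ker fun w => w = v) (by
    rintro a b ⟨-, hab | hab⟩
    · exact eq_iff_iff.2 (iff_of_false (key a b hab).1 (key a b hab).2)
    · exact eq_iff_iff.2 (iff_of_false (key b a hab).2 (key b a hab).1))
  exact hu ((eq_iff_iff.1 this).1 rfl)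

/-- A face through an open propagator, of a colour other than that of the vertex, has length one. -/
theorem reachable_of_colour_ne {i : Fin d} {x : V × Bool} (hx : x ∈ G.whiteExternal)
    (hi : G.colour x.1 ≠ i) {y : Node V} (h : (G.stranded i).Reachable (Sum.inl x) y) :
    y = Sum.inl x ∨ y = Sum.inr x := by
  have hx' : G.colourToggle i x = x := toggle_of_notMem hi
  have := G.rel_of_reachable (Setoid.ker fun y : Node V => y = Sum.inl x ∨ y = Sum.inr x)
    (fun w => ?_) (fun w b hb => ?_) h
  · exact (eq_iff_iff.1 this).1 (Or.inl rfl)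
  · refine eq_iff_iff.2 ?_
    simp only [Sum.inl.injEq, Sum.inr.injEq, reduceCtorEq, or_false, false_or]
    constructor
    · rintro rfl
      exact hx'
    · intro h
      rw [← toggle_toggle (S := {v | G.colour v = i}) w, h, hx']
  · refine eq_iff_iff.2 ?_
    simp only [Sum.inl.injEq, Sum.inr.injEq, reduceCtorEq, or_false, false_or]
    constructor
    · rintro rfl
      rw [show G.line w = none from hx] at hb
      cases hb
    · rintro rfl
      exact absurd hb (notMem_line hext hx)

/-- The edge with the colour of the bubble leads to the black node of the other pair, which is not
external, so a propagator continues the face. -/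
theorem exists_reachable_of_colour [Fintype V] (hG : G.IsConnected)
    (hV : 1 < Fintype.card V) {x : V × Bool} (hx : x ∈ G.whiteExternal) :
    ∃ y ∉ G.whiteExternal, (G.stranded (G.colour x.1)).Reachable (Sum.inl x) (Sum.inl y) := by
  have hx' : G.colourToggle (G.colour x.1) x = (x.1, !x.2) := toggle_of_mem rfl
  have h := hG.not_mem_whiteExternal hext hV (v := x.1) (s := x.2) hx
  rw [← hx', ← hext] at h
  obtain ⟨y, hy⟩ := Option.ne_none_iff_exists'.1 h
  have hy' : G.colourToggle (G.colour x.1) x ∈ G.line y := G.line.mem_iff_mem.1 hy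
  refine ⟨y, fun hyX => ?_, (G.reachable_bubble _ x).trans (G.reachable_line _ hy').symm⟩
  rw [show G.line y = none from hyX] at hy'
  cases hy'

end Paired

/-- Two distinct white nodes hooked to external edges lie on different faces of each colour. -/
theorem eq_of_reachable {i : Fin d} {x y : V × Bool} (hx : x ∈ G.whiteExternal)
    (hy : y ∈ G.whiteExternal) (h : (G.stranded i).Reachable (Sum.inl x) (Sum.inl y)) : x = y := by
  -- One step along the face, with default `w` so that external white nodes are fixed. Whether the
  -- forward walk ends at `y` is then an invariant of the face, and the walk from `x` stays at `x`.
  let step : V × Bool → V × Bool := fun w => ((G.line w).map (G.colourToggle i)).getD w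
  have hstep : ∀ w ∈ G.whiteExternal, step w = w := by
    intro w hw
    simp only [step, show G.line w = none from hw, Option.map_none, Option.getD_none]
  have := G.rel_of_reachable
    (Setoid.ker fun z : Node V => ∃ k : ℕ, step^[k] (G.whiteEnd i z) = y)
    (fun w => ?_) (fun w b hb => ?_) h
  · obtain ⟨k, hk⟩ := (eq_iff_iff.1 this).2 ⟨0, rfl⟩
    exact (Function.iterate_fixed (hstep x hx) k).symm.trans hk
  · simp only [Setoid.ker_def, whiteEnd, toggle_toggle]
  · have hw : G.whiteEnd i (Sum.inr b) = step w := by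
      simp only [step, show G.line w = some b from hb, Option.map_some, Option.getD_some, whiteEnd]
    simp only [Setoid.ker_def, hw, eq_iff_iff]
    constructor
    · rintro ⟨k, hk⟩
      refine ⟨k, ?_⟩
      change step^[k] w = y at hk
      rw [← Function.iterate_succ_apply, Function.iterate_succ_apply', hk, hstep y hy]
    · rintro ⟨k, hk⟩
      exact ⟨k + 1, hk⟩

/-- All the external vertices of a 1PI melonic diagram have the same colour. -/
theorem colour_eq_of_mem_whiteExternal [Fintype V] (hconn : ∀ p q, joined τ Set.univ p q)
    (hfix : ∀ x ∈ G.whiteExternal, τ x = x)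
    (hpair : ∀ v s, (v, s) ∈ G.whiteExternal → (v, !s) ∉ G.whiteExternal)
    (hsat : ∀ E : Finset V, cyclomatic τ E = Fintype.card V + 1 ∧
      defect G.colour G.whiteExternal τ E = defect G.colour G.whiteExternal τ ∅)
    {x y : V × Bool} (hx : x ∈ G.whiteExternal) (hy : y ∈ G.whiteExternal) :
    G.colour x.1 = G.colour y.1 := by
  classical
  by_contra hne
  -- `B` holds at the external bubbles whose colour differs from that of `y`; `E` keeps all the
  -- others switched on.
  let B : V → Prop := fun v => ∃ s, (v, s) ∈ G.whiteExternal ∧ G.colour v ≠ G.colour y.1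
  let E : Finset V := Finset.univ.filter fun v => ¬ B v
  have hE : ∀ v, v ∈ E ↔ ¬ B v := fun v => by simp [E]
  obtain ⟨v, s⟩ := x
  have hvB : B v := ⟨s, hx, hne⟩
  have hvE : v ∉ E := fun h => (hE v).1 h hvB
  -- Each bubble in `B` ends at a leaf, a fixed point of `τ`. `φ` retracts these leaves to the
  -- opposite ends, showing that the rest stays connected once the bubbles in `B` are switched off.
  let φ : V × Bool → V × Bool := fun p =>
    if p ∈ G.whiteExternal ∧ B p.1 then (p.1, !p.2) else p
  have hφ : joined τ Set.univ ≤ (joined τ (E : Set V)).comap φ := by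
    refine joined_le (fun p => ?_) fun u _ => ?_
    · rw [Setoid.comap_rel]
      by_cases hp : p ∈ G.whiteExternal
      · rw [hfix p hp]
      · have hp' : τ p ∉ G.whiteExternal := fun h => hp (τ.injective (hfix _ h) ▸ h)
        simp only [φ, hp, hp', false_and, if_false]
        exact joined_apply p
    · rw [Setoid.comap_rel]
      by_cases hu : B u
      · obtain ⟨t, ht, -⟩ := id hu
        have ht' := hpair u t ht
        cases t
        · have ht'' : (u, true) ∉ G.whiteExternal := ht'
          simp only [φ, ht, ht'', hu, and_self, if_true, false_and, if_false]
          exact Setoid.refl' _ _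
        · have ht'' : (u, false) ∉ G.whiteExternal := ht'
          simp only [φ, ht, ht'', hu, and_self, if_true, false_and, if_false]
          exact Setoid.refl' _ _
      · simp only [φ, hu, and_false, if_false]
        exact joined_not (s := false) ((hE u).2 hu)
  have hjoin : joined τ (E : Set V) y (v, !s) := by
    have h := hφ (hconn y (v, s))
    rw [Setoid.comap_rel] at h
    have hyB : ¬ B y.1 := fun ⟨_, _, h⟩ => h rfl
    simpa only [φ, hx, hvB, hyB, and_self, and_false, if_true, if_false] using h
  have hnot : ¬ joined τ (E : Set V) (v, false) (v, true) := by
    intro h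
    have := cyclomatic_insert_of_joined hvE h
    rw [(hsat _).1, (hsat _).1] at this
    omega
  have hmeets : ∀ t, (joined τ (E : Set V)).Meets G.whiteExternal (v, t) := by
    intro t
    rcases Bool.eq_or_eq_not t s with rfl | rfl
    · exact ⟨(v, t), hx, Setoid.refl' _ _⟩
    · exact ⟨y, hy, hjoin⟩
  -- Both sides of `v` meet the external nodes, at `(v, s)` and at `y`, so constancy of the defect
  -- forces the cycle of colour `G.colour v` through `(v, !s)` to contain an external `z`.
  obtain ⟨z, hz, hzv⟩ := meets_of_defect_insert_eq G.colour G.whiteExternal hvE hnot hmeets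
    ((hsat _).2.trans (hsat _).2.symm) (!s)
  -- A bubble of `E` with the colour of `v` cannot be external, since it would lie in `B`. So
  -- nothing moves `z`, its cycle is a single point, and `z = (v, !s)` contradicts `hpair`.
  have hzfix : Function.IsFixedPt (toggle {u | u ∈ E ∧ G.colour u = G.colour v} * τ) z := by
    rw [Function.IsFixedPt, mul_apply, hfix z hz]
    refine toggle_of_notMem fun hzE => (hE z.1).1 hzE.1 ⟨z.2, hz, ?_⟩
    rw [hzE.2]
    exact hne
  have hzv' : z = (v, !s) := SameCycle.eq_of_left hzv hzfix
  rw [hzv'] at hz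
  exact hpair v s hx hz

end QuarticDiagram

/-! ### Counting external edges and external faces. -/

namespace QuarticDiagram

variable {d : ℕ} {V : Type*} {G : QuarticDiagram d V}

theorem externalEdges_eq (hext : ∀ b, G.IsExternalNode (Sum.inr b) ↔ b ∈ G.whiteExternal) :
    G.externalEdges = Sum.inl '' G.whiteExternal ∪ Sum.inr '' G.whiteExternal := by
  ext (w | b)
  · simp only [externalEdges, Set.mem_ofPred_eq, Set.mem_union, Set.mem_image, Sum.inl.injEq,
      exists_eq_right, reduceCtorEq, and_false, exists_false, or_false]
    rfl
  · simp only [externalEdges, Set.mem_ofPred_eq, Set.mem_union, Set.mem_image, Sum.inr.injEq,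
      exists_eq_right, reduceCtorEq, and_false, exists_false, false_or]
    exact hext b

theorem ncard_externalEdges [Finite V]
    (hext : ∀ b, G.IsExternalNode (Sum.inr b) ↔ b ∈ G.whiteExternal) :
    G.externalEdges.ncard = 2 * G.whiteExternal.ncard := by
  rw [externalEdges_eq hext, Set.ncard_union_eq, Set.ncard_image_of_injective _ Sum.inl_injective,
    Set.ncard_image_of_injective _ Sum.inr_injective, two_mul]
  rw [Set.disjoint_left]
  rintro _ ⟨w, -, rfl⟩ ⟨b, -, h⟩
  cases h

theorem whiteExternal_nonempty [Finite V] (h : G.externalEdges.Nonempty) :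
    G.whiteExternal.Nonempty := by
  obtain ⟨w | b, hx⟩ := h
  · exact ⟨w, hx⟩
  by_contra hX
  obtain ⟨τ, hτ, -⟩ := G.line.exists_perm_extension
  have hempty : ∀ w, w ∉ G.whiteExternal := fun w hw => hX ⟨w, hw⟩
  -- With no external white node the fixed-point hypothesis is vacuous, so no black node could be
  -- external either.
  exact hX ⟨b, (isExternalNode_inr_iff hτ (fun x hx => absurd hx (hempty x)) b).1 hx⟩

theorem externalEdgesAt_eq (hext : ∀ b, G.IsExternalNode (Sum.inr b) ↔ b ∈ G.whiteExternal)
    (hpair : ∀ v s, (v, s) ∈ G.whiteExternal → (v, !s) ∉ G.whiteExternal) {v : V} {s : Bool}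
    (h : (v, s) ∈ G.whiteExternal) :
    G.externalEdgesAt v = {Sum.inl (v, s), Sum.inr (v, s)} := by
  have key : ∀ t, (v, t) ∈ G.whiteExternal → t = s := by
    intro t ht
    rcases Bool.eq_or_eq_not t s with e | rfl
    · exact e
    · exact absurd ht (hpair v s h)
  ext x
  constructor
  · rintro ⟨hx, hv⟩
    obtain ⟨u, t⟩ | ⟨u, t⟩ := x
    · obtain rfl : u = v := hv
      rw [key t hx]
      exact Or.inl rfl
    · obtain rfl : u = v := hv
      rw [key t ((hext _).1 hx)]
      exact Or.inr rfl
  · rintro (rfl | rfl)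
    · exact ⟨h, rfl⟩
    · exact ⟨(hext _).2 h, rfl⟩

/-- The face of colour `i` through the white node `w`. -/
def faceThrough (G : QuarticDiagram d V) (i : Fin d) (w : V × Bool) : G.Face :=
  ⟨i, (G.stranded i).connectedComponentMk (Sum.inl w)⟩

theorem mem_nodes_faceThrough {i : Fin d} {w : V × Bool} {x : Node V} :
    x ∈ (G.faceThrough i w).nodes ↔ (G.stranded i).Reachable (Sum.inl w) x :=
  SimpleGraph.ConnectedComponent.eq.trans SimpleGraph.reachable_comm

theorem self_mem_nodes_faceThrough (i : Fin d) (w : V × Bool) :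
    Sum.inl w ∈ (G.faceThrough i w).nodes := rfl

theorem eq_faceThrough {f : G.Face} {w : V × Bool} (h : Sum.inl w ∈ f.nodes) :
    f = G.faceThrough f.colour w := by
  obtain ⟨i, C⟩ := f
  have : (G.stranded i).connectedComponentMk (Sum.inl w) = C := h
  subst this
  rfl

theorem isExternal_faceThrough {i : Fin d} {x : V × Bool} (hx : x ∈ G.whiteExternal) :
    (G.faceThrough i x).IsExternal :=
  ⟨_, self_mem_nodes_faceThrough i x, hx⟩

section Paired

variable (hext : ∀ b, G.IsExternalNode (Sum.inr b) ↔ b ∈ G.whiteExternal)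
include hext

theorem not_runsThroughInterior_of_colour_ne {i : Fin d} {x : V × Bool}
    (hx : x ∈ G.whiteExternal) (hi : G.colour x.1 ≠ i) :
    ¬ (G.faceThrough i x).RunsThroughInterior := by
  rintro ⟨w, hw, hwf⟩
  rw [internalEdges_eq] at hw
  rcases reachable_of_colour_ne hext hx hi (mem_nodes_faceThrough.1 hwf) with h | h
  · rw [Sum.inl.inj h] at hw
    exact hw hx
  · cases h

variable [Fintype V] (hG : G.IsConnected) (hV : 1 < Fintype.card V)
include hG hV

theorem runsThroughInterior_of_colour_eq {x : V × Bool} (hx : x ∈ G.whiteExternal) :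
    (G.faceThrough (G.colour x.1) x).RunsThroughInterior := by
  obtain ⟨y, hy, hxy⟩ := exists_reachable_of_colour hext hG hV hx
  refine ⟨y, ?_, mem_nodes_faceThrough.2 hxy⟩
  rw [internalEdges_eq]
  exact hy

theorem length_faceThrough_eq_one_iff {i : Fin d} {x : V × Bool} (hx : x ∈ G.whiteExternal) :
    (G.faceThrough i x).length = 1 ↔ i ≠ G.colour x.1 := by
  constructor
  · rintro h rfl
    obtain ⟨y, hy, hxy⟩ := exists_reachable_of_colour hext hG hV hx
    obtain ⟨z, hz⟩ := Set.ncard_eq_one.1 h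
    have h1 : x ∈ ({z} : Set _) := hz ▸ self_mem_nodes_faceThrough (G.colour x.1) x
    have h2 : y ∈ ({z} : Set _) := hz ▸ mem_nodes_faceThrough.2 hxy
    rw [Set.mem_singleton_iff.1 h2, ← Set.mem_singleton_iff.1 h1] at hy
    exact hy hx
  · intro hi
    refine Set.ncard_eq_one.2 ⟨x, Set.eq_singleton_iff_unique_mem.2
      ⟨self_mem_nodes_faceThrough i x, fun y hy => ?_⟩⟩
    rcases reachable_of_colour_ne hext hx hi.symm (mem_nodes_faceThrough.1 hy) with h | h
    · exact Sum.inl.inj h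
    · cases h

theorem ncard_short_faces {x : V × Bool} (hx : x ∈ G.whiteExternal) :
    {f ∈ G.externalFaces | f.length = 1 ∧ Sum.inl x ∈ f.nodes ∧ Sum.inr x ∈ f.nodes}.ncard =
      d - 1 := by
  have : {f ∈ G.externalFaces | f.length = 1 ∧ Sum.inl x ∈ f.nodes ∧ Sum.inr x ∈ f.nodes} =
      (fun i => G.faceThrough i x) '' {G.colour x.1}ᶜ := by
    ext f
    constructor
    · rintro ⟨-, hlen, hxf, -⟩
      have hf := eq_faceThrough hxf
      rw [hf, length_faceThrough_eq_one_iff hext hG hV hx] at hlen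
      exact ⟨f.colour, hlen, hf.symm⟩
    · rintro ⟨i, hi, rfl⟩
      refine ⟨isExternal_faceThrough hx, (length_faceThrough_eq_one_iff hext hG hV hx).2 hi,
        self_mem_nodes_faceThrough i x, mem_nodes_faceThrough.2 ?_⟩
      have h := G.reachable_bubble i x
      rwa [Equiv.Perm.toggle_of_notMem fun e : G.colour x.1 = i => hi e.symm] at h
  have hinj : Function.Injective fun i => G.faceThrough i x := fun i j h => congrArg Sigma.fst h
  rw [this, Set.ncard_image_of_injective _ hinj, Set.ncard_compl, Set.ncard_singleton,
    Nat.card_eq_fintype_card, Fintype.card_fin]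

end Paired

end QuarticDiagram

open QuarticDiagram in
theorem mainTheorem5 (d : ℕ) (hd : 3 ≤ d) {V : Type*} [Fintype V] (G : QuarticDiagram d V)
    (N : ℕ) (hN : 1 ≤ N) (hpoint : G.externalEdges.ncard = 2 * N)
    (hV : 1 < Fintype.card V) (hPI : G.IsOnePI) (hmel : G.IsMelonic) :
    (∀ v : V, G.IsExternalVertex v →
      ∃ x y : QuarticDiagram.Node V, x ≠ y ∧ G.externalEdgesAt v = {x, y} ∧
        {f ∈ G.externalFaces | f.length = 1 ∧ x ∈ f.nodes ∧ y ∈ f.nodes}.ncard = d - 1) ∧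
    (∃ i : Fin d,
      {f ∈ G.externalFaces | f.RunsThroughInterior}.ncard = N ∧
        ∀ f ∈ G.externalFaces, f.RunsThroughInterior → f.colour = i) := by
  have hX : G.whiteExternal.Nonempty :=
    whiteExternal_nonempty (Set.nonempty_of_ncard_ne_zero (by omega))
  obtain ⟨τ, hτ, hsep⟩ := G.line.exists_perm_extension
  have hsat := hmel.cyclomatic_and_defect hd hX hτ hsep
  have hfix : ∀ x ∈ G.whiteExternal, τ x = x := fun x hx =>
    hPI.apply_eq_self ((Equiv.Perm.cyclomatic_empty τ).symm.trans (hsat ∅).1) hτ hsep hx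
  have hext := isExternalNode_inr_iff hτ hfix
  have hpair : ∀ v s, (v, s) ∈ G.whiteExternal → (v, !s) ∉ G.whiteExternal :=
    fun v s h => hPI.1.not_mem_whiteExternal hext hV h
  refine ⟨fun v hv => ?_, ?_⟩
  · obtain ⟨s, hs⟩ : ∃ s, (v, s) ∈ G.whiteExternal := by
      obtain ⟨⟨u, s⟩ | ⟨u, s⟩, hx, rfl⟩ := hv
      · exact ⟨s, hx⟩
      · exact ⟨s, (hext _).1 hx⟩
    exact ⟨Sum.inl (v, s), Sum.inr (v, s), Sum.inl_ne_inr, externalEdgesAt_eq hext hpair hs,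
      ncard_short_faces hext hPI.1 hV hs⟩
  · obtain ⟨x₀, hx₀⟩ := hX
    have hcol : ∀ x ∈ G.whiteExternal, G.colour x.1 = G.colour x₀.1 := fun x hx =>
      colour_eq_of_mem_whiteExternal (joined_of_connected hPI.1 fun x y _ => hτ x y) hfix hpair
        hsat hx hx₀
    have key : ∀ f ∈ G.externalFaces, f.RunsThroughInterior →
        ∃ x ∈ G.whiteExternal, G.faceThrough (G.colour x₀.1) x = f := by
      intro f hf hrun
      obtain ⟨x, hx, hxf⟩ := (isExternal_iff hτ f).1 hf
      have hf' := eq_faceThrough hxf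
      have hc : G.colour x.1 = f.colour := by
        by_contra hne
        rw [hf'] at hrun
        exact not_runsThroughInterior_of_colour_ne hext hx hne hrun
      exact ⟨x, hx, by rw [← hcol x hx, hc, ← hf']⟩
    refine ⟨G.colour x₀.1, ?_, fun f hf hrun => ?_⟩
    · have himg : {f ∈ G.externalFaces | f.RunsThroughInterior} =
          G.faceThrough (G.colour x₀.1) '' G.whiteExternal := by
        refine Set.Subset.antisymm (fun f hf => key f hf.1 hf.2) ?_
        rintro _ ⟨x, hx, rfl⟩
        refine ⟨isExternal_faceThrough hx, ?_⟩
        rw [← hcol x hx]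
        exact runsThroughInterior_of_colour_eq hext hPI.1 hV hx
      have hinj : Set.InjOn (G.faceThrough (G.colour x₀.1)) G.whiteExternal := by
        intro x hx y hy hxy
        refine eq_of_reachable (i := G.colour x₀.1) hx hy (mem_nodes_faceThrough.1 ?_)
        rw [hxy]
        exact self_mem_nodes_faceThrough _ y
      have := ncard_externalEdges hext
      rw [himg, hinj.ncard_image]
      omega
    · obtain ⟨x, -, rfl⟩ := key f hf hrun
      rfl
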